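/- **Theorem (The Inevitability Theorem).** Let $X$ be a finite alphabet and let $M$ be a finite $X$-generated group mapping monoid; that is, $M$ has a $0$-minimal regular ideal $I$ which contains a non-trivial group and on whose left and right $M$ acts faithfully. Let $R$ be a (nonzero) $\mathscr R$-class of $I$, on which $M$ acts on the right by partial transformations ($rm$ is defined if and only if $rm\in R$). Let $n\ge 0$. Then every $\mathcal F_n$-state of the set-partition flow lattice $L=\mathsf{SP}(M,X)$ is $\mathbf C_n$-inevitable. The terms are as follows. *Set-partitions.* $L$ is the lattice of all pairs $(Y,P)$ with $Y\subseteq R$ and $P$ a partition of $Y$, where $(Y,P)\le (Z,Q)$ means that $Y\subseteq Z$ and each block of $P$ lies in a block of $Q$. Its bottom is $B=(\emptyset,\emptyset)$; the points are $(r,r):=(\{r\},\{\{r\}\})$, $r\in R$. *Abstract flows.* An abstract flow is a closure operator $f$ on $L\times L$; it is identified with its set $\overline f\subseteq L\times L$ of stable (closed) pairs, an arbitrary meet-closed relation on $L$, and one writes $\ell\xrightarrow{\overline f}\ell'$ for $(\ell,\ell')\in\overline f$. Abstract flows form a finite monoid under composition of relations (left to right), with the equality relation as identity $1$. A closure operator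 $c$ on $L$ is viewed as the abstract flow with stable pairs $(\ell,\ell)$, $c(\ell)=\ell$. For an abstract flow $f$: $\overleftarrow f$ (back-flow) is the closure operator on $L$ with closed set $\{\ell : \exists \ell',\ \ell\xrightarrow{\overline f}\ell'\}$; $f^*$ is the closure operator with closed set $\{\ell:\ell\xrightarrow{\overline f}\ell\}$; $\ell\overrightarrow f$ (forward-flow) is the second coordinate of $f(\ell,B)$; and $f^{\omega+*}=f^\omega f^*$, where $f^\omega$ is the idempotent positive power of $f$. Free flow along $x\in X$ is the abstract flow with $(U,P)\xrightarrow{\overline x}(Y,Q)$ if and only if $Ux\subseteq Y$ and, for all $a,b\in U$ with $ax,bx\in R$, $a\mathrel P b\iff ax\mathrel Q bx$. *Complexity.* A monoid has complexity at most $n$ (belongs to $\mathbf C_n$) if for some $m\le n$ it divides a wreath product $A_m\wr G_m\wr A_{m-1}\wr\cdots\wr A_1\wr G_1\wr A_0$ of finite aperiodic monoids $A_i$ and finite groups $G_i$. *Loopable elements.* A relational morphism $\varphi\colon S\to N$ of monoids is a relation whose graph is a submonoid of $S\times N$ projecting onto $S$. A submonoid $T$ of a finite monoid $S$ is Type I if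 for every relational morphism $\varphi$ from $S$ to a finite aperiodic monoid $N$ there is a submonoid $N'\le N$ whose idempotents generate an $\mathscr R$-trivial monoid and with $T\subseteq N'\varphi^{-1}$. $\mathsf K_{\mathbf G}(S)$ is the submonoid of all $s\in S$ that are related to $1$ under every relational morphism from $S$ to a finite group. Every $s\in S$ is $0$-loopable in $S$; for $n\geq 1$, $s$ is $n$-loopable in $S$ if there is a Type I submonoid $T$ of $S$ such that $s$ is an $(n-1)$-loopable element of $\mathsf K_{\mathbf G}(T)$. *Flow monoid and vacuum.* $\mathsf M_n(L)$ is the least submonoid $K$ of the monoid of abstract flows that contains free flow along each $x\in X$ and satisfies: $f\in K\Rightarrow\overleftarrow f\in K$; and $f^{\omega+*}\in K$ whenever $f\in K$ is $n$-loopable in $K$. The vacuum is $\mathcal F_n=\bigvee_{f\in\mathsf M_n(L)}\overleftarrow f$, the join being taken in the lattice of closure operators on $L$. *Formulae.* Well-formed formulae over $X$ are built from the empty formula $\varepsilon$ and the letters $x\in X$ by (associative) concatenation and by the formation of $\tau^{\omega+*}$ for $\tau$ not a proper power, i.e. not of the form $\sigma^k$ with $k\ge 2$. They are interpreted as abstract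 flows, partially, by $\varepsilon\mapsto\mathcal F_n$, $x\mapsto\mathcal F_n x\mathcal F_n$, concatenation $\mapsto$ product, and, if $\tau$ is not a proper power and is interpreted by an $f$ that is $n$-loopable in $\mathsf M_n(L)$, $\tau^{\omega+*}\mapsto f^{\omega+*}$. *States.* The set of $\mathcal F_n$-states is the smallest subset $\Sigma$ of $L$ such that: $(r,r)\in\Sigma$ for all $r\in R$; $\ell\overrightarrow\tau\in\Sigma$ for all $\ell\in\Sigma$ and all well-formed formulae $\tau$ whose interpretation (also denoted $\tau$) is defined; and $\ell\mathcal F_n\in\Sigma$ whenever $\ell\le\ell'$ for some $\ell'\in\Sigma$. *Inevitability.* Let $\mathscr A=(Q,X)$ be a finite partial deterministic automaton; its transition monoid is the monoid of partial transformations of $Q$ generated by the letters. A complete flow on $\mathscr A$ is a map $F\colon Q\to L$ such that, for all $q\in Q$ and $x\in X$, $qF\xrightarrow{\overline x}(qx)F$ if $qx$ is defined and $qF\xrightarrow{\overline x}B$ otherwise, and such that for each $r\in R$ some $q\in Q$ satisfies $(r,r)\le qF$. An element $\ell\in L$ is $\mathbf C_n$-inevitable if for every complete flow $F$ on a partial automaton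 $(Q,X)$ with transition monoid in $\mathbf C_n$ there is a state $q\in Q$ with $\ell\le qF$. -/

import Mathlib

/-!
Flows on automata and group complexity of finite monoids.

Conventions: maps act on the right of their arguments, so products of partial transformations, of
binary relations and of abstract flows are read from left to right.  All monoids, automata and
alphabets to which the notions below are applied are finite; since a finite monoid or a finite set
is isomorphic to one in `Type`, the auxiliary finite objects over which a definition quantifies are
taken in `Type`.
-/

namespace FlowBound

universe u v

/-! ### Finite monoids: aperiodic monoids, relational morphisms, complexity -/

section Monoids

/-- A (finite) monoid is aperiodic if `a ^ (k + 1) = a ^ k` for `k` large, for each element `a`. -/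
def IsAperiodic (N : Type u) [Monoid N] : Prop :=
  ∀ a : N, ∃ k : ℕ, a ^ (k + 1) = a ^ k

/-- `a` and `b` generate the same principal right ideal (Green's relation `R`). -/
def RRel {N : Type u} [Monoid N] (a b : N) : Prop :=
  (∃ x, a * x = b) ∧ ∃ y, b * y = a

/-- `N` belongs to `ER`: its idempotents generate an `R`-trivial submonoid. -/
def IsER (N : Type u) [Monoid N] : Prop :=
  ∀ a b : Submonoid.closure {e : N | IsIdempotentElem e}, RRel a b → a = b

/-- A relational morphism of monoids `S → N`, given by its graph: a submonoid of `S × N` that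
projects onto `S`. -/
def IsRelationalMorphism {S : Type u} {N : Type v} [Monoid S] [Monoid N]
    (φ : Submonoid (S × N)) : Prop :=
  ∀ s : S, ∃ t : N, (s, t) ∈ φ

/-- `S` divides `W`: `S` is a homomorphic image of a submonoid of `W`. -/
def Divides (S : Type u) (W : Type v) [Monoid S] [Monoid W] : Prop :=
  ∃ (T : Submonoid W) (f : T →* S), Function.Surjective f

/-- The wreath product `U ≀ V`, i.e. the semidirect product of `V → U` with `V`. -/
@[ext]
structure Wreath (U : Type u) (V : Type v) where
  base : V → U
  top : V

instance (U : Type u) (V : Type v) [Monoid U] [Monoid V] : Monoid (Wreath U V) where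
  mul p q := ⟨fun x => p.base x * q.base (x * p.top), p.top * q.top⟩
  one := ⟨fun _ => 1, 1⟩
  mul_assoc p q r := by
    refine Wreath.ext (funext fun x => ?_) (mul_assoc _ _ _)
    change (p.base x * q.base (x * p.top)) * r.base (x * (p.top * q.top)) =
      p.base x * (q.base (x * p.top) * r.base (x * p.top * q.top))
    simp only [mul_assoc]
  one_mul p := by
    refine Wreath.ext (funext fun x => ?_) (one_mul _)
    change 1 * p.base (x * 1) = p.base x
    simp
  mul_one p := by
    refine Wreath.ext (funext fun x => ?_) (mul_one _)
    change p.base x * 1 = p.base x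
    simp

/-- `W` is a wreath product `A_n ≀ G_n ≀ A_{n-1} ≀ ⋯ ≀ A_1 ≀ G_1 ≀ A_0`, bracketed from the left,
with finite aperiodic monoids `A_i` and finite groups `G_i`. -/
inductive IsKRProduct : ℕ → (W : Type) → Monoid W → Prop
  | aperiodic (A : Type) [Monoid A] [Finite A] (hA : IsAperiodic A) :
      IsKRProduct 0 A inferInstance
  | step (n : ℕ) (U G A : Type) [Monoid U] [Group G] [Monoid A] [Finite G] [Finite A]
      (hU : IsKRProduct n U inferInstance) (hA : IsAperiodic A) :
      IsKRProduct (n + 1) (Wreath (Wreath U G) A) inferInstance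

/-- `S` has group complexity at most `n`. -/
def ComplexityLE (n : ℕ) (S : Type u) [Monoid S] : Prop :=
  ∃ m ≤ n, ∃ (W : Type) (_ : Monoid W), IsKRProduct m W inferInstance ∧ Divides S W

/-- A submonoid `T` of `S` is Type I if, for every relational morphism from `S` to a finite
aperiodic monoid `N`, some submonoid `N'` of `N` in `ER` satisfies `T ⊆ N' φ⁻¹`. -/
def IsTypeI {S : Type u} [Monoid S] (T : Submonoid S) : Prop :=
  ∀ (N : Type) [Monoid N] [Finite N], IsAperiodic N →
    ∀ φ : Submonoid (S × N), IsRelationalMorphism φ →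
      ∃ N' : Submonoid N, IsER N' ∧ ∀ s ∈ T, ∃ t ∈ N', (s, t) ∈ φ

/-- The submonoid of Type II elements of `S`: those related to `1` under every relational morphism
from `S` to a finite group. -/
def typeII (S : Type u) [Monoid S] : Submonoid S where
  carrier := {s | ∀ (G : Type) [Group G] [Finite G],
    ∀ φ : Submonoid (S × G), IsRelationalMorphism φ → (s, (1 : G)) ∈ φ}
  one_mem' := fun _ _ _ φ _ => φ.one_mem
  mul_mem' := fun ha hb G _ _ φ hφ => by
    simpa using φ.mul_mem (ha G φ hφ) (hb G φ hφ)

/-- `n`-loopable elements of a monoid. -/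
def IsLoopable : ℕ → (S : Type u) → [Monoid S] → S → Prop
  | 0, _, _, _ => True
  | n + 1, S, _, s => ∃ T : Submonoid S, IsTypeI T ∧
      ∃ t : typeII T, ((t : T) : S) = s ∧ IsLoopable n (typeII T) t

/-- The power `s ^ ω`: the unique idempotent among the powers `s ^ k`, `k ≥ 1`, of an element of a
finite monoid. -/
noncomputable def omegaPow {S : Type u} [Monoid S] (s : S) : S :=
  s ^ sInf {k : ℕ | 0 < k ∧ IsIdempotentElem (s ^ k)}

theorem IsTypeI.map {S S' : Type u} [Monoid S] [Monoid S'] (j : S →* S') {T : Submonoid S}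
    (hT : IsTypeI T) : IsTypeI (T.map j) := by
  intro N _ _ hN φ hφ
  obtain ⟨N', hN', h⟩ := hT N hN (φ.comap (j.prodMap (MonoidHom.id N))) fun s => hφ (j s)
  refine ⟨N', hN', ?_⟩
  rintro _ ⟨s, hs, rfl⟩
  exact h s hs

theorem map_mem_typeII {S S' : Type u} [Monoid S] [Monoid S'] (j : S →* S') {s : S}
    (hs : s ∈ typeII S) : j s ∈ typeII S' := fun G _ _ φ hφ =>
  hs G (φ.comap (j.prodMap (MonoidHom.id G))) fun s => hφ (j s)

/-- Homomorphisms, in particular inclusions of submonoids, preserve loopable elements. -/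
theorem IsLoopable.map (n : ℕ) : ∀ {S S' : Type u} [Monoid S] [Monoid S'] (j : S →* S') {s : S},
    IsLoopable n S s → IsLoopable n S' (j s) := by
  induction n with
  | zero => intros; trivial
  | succ n ih =>
    rintro S S' _ _ j s ⟨T, hT, t, rfl, ht⟩
    let k : T →* T.map j := (j.comp T.subtype).codRestrict (T.map j)
      fun x => Submonoid.mem_map_of_mem j x.2
    let k' : typeII T →* typeII (T.map j) := (k.comp (typeII T).subtype).codRestrict _
      fun x => map_mem_typeII k x.2
    exact ⟨T.map j, hT.map j, k' t, rfl, ih k' ht⟩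

end Monoids

/-! ### Abstract flows -/

section Flows

variable {L : Type u} [CompleteLattice L]

/-- An abstract flow on `L` is a closure operator on `L × L`; it is identified with the binary
relation on `L` consisting of its stable pairs. -/
abbrev AbstractFlow (L : Type u) [CompleteLattice L] : Type u := ClosureOperator (L × L)

/-- `(a, b)` is a stable pair of `f`. -/
def Stable (f : AbstractFlow L) (a b : L) : Prop := f.IsClosed (a, b)

/-- The abstract flow with a given meet-closed relation as its set of stable pairs. -/
def ofRel (r : L → L → Prop)
    (h : ∀ s : Set (L × L), (∀ p ∈ s, r p.1 p.2) → r (sInf s).1 (sInf s).2) : AbstractFlow L :=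
  ClosureOperator.ofCompletePred (fun p => r p.1 p.2) h

theorem stable_sInf (f : AbstractFlow L) (s : Set (L × L)) (h : ∀ p ∈ s, Stable f p.1 p.2) :
    Stable f (sInf s).1 (sInf s).2 := by
  refine f.isClosed_iff_closure_le.2 (le_sInf fun p hp => ?_)
  exact ClosureOperator.closure_min (sInf_le hp) (h p hp)

/-- The product of two abstract flows: its stable pairs form the composite relation. -/
def flowMul (f g : AbstractFlow L) : AbstractFlow L :=
  ofRel (fun a b => ∃ c, Stable f a c ∧ Stable g c b) (by
    intro s hs
    choose! c hc using hs
    refine ⟨sInf (c '' s), ?_, ?_⟩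
    · have := stable_sInf f ((fun p => (p.1, c p)) '' s) (by
        rintro _ ⟨p, hp, rfl⟩; exact (hc p hp).1)
      simpa [Prod.fst_sInf, Prod.snd_sInf, Set.image_image] using this
    · have := stable_sInf g ((fun p => (c p, p.2)) '' s) (by
        rintro _ ⟨p, hp, rfl⟩; exact (hc p hp).2)
      simpa [Prod.fst_sInf, Prod.snd_sInf, Set.image_image] using this)

/-- A closure operator `c` on `L`, viewed as an abstract flow: its stable pairs are the `(a, a)`
with `a` closed under `c`. -/
def diag (c : ClosureOperator L) : AbstractFlow L :=
  ofRel (fun a b => a = b ∧ c.IsClosed a) (by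
    intro s hs
    have h1 : (sInf s).1 = (sInf s).2 := by
      rw [Prod.fst_sInf, Prod.snd_sInf]
      exact congrArg sInf (Set.image_congr fun p hp => (hs p hp).1)
    refine ⟨h1, c.isClosed_iff_closure_le.2 ?_⟩
    rw [Prod.fst_sInf]
    refine le_sInf ?_
    rintro _ ⟨p, hp, rfl⟩
    exact ClosureOperator.closure_min (sInf_le ⟨p, hp, rfl⟩) (hs p hp).2)

/-- The abstract flow monoid; its identity corresponds to the equality relation. -/
instance : Monoid (AbstractFlow L) where
  mul := flowMul
  one := diag (ClosureOperator.id L)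
  mul_assoc f g h := ClosureOperator.ext_isClosed _ _ fun p => by
    change (∃ c, (∃ d, Stable f p.1 d ∧ Stable g d c) ∧ Stable h c p.2) ↔
      ∃ d, Stable f p.1 d ∧ ∃ c, Stable g d c ∧ Stable h c p.2
    exact ⟨fun ⟨c, ⟨d, h1, h2⟩, h3⟩ => ⟨d, h1, c, h2, h3⟩,
      fun ⟨d, h1, c, h2, h3⟩ => ⟨c, ⟨d, h1, h2⟩, h3⟩⟩
  one_mul f := ClosureOperator.ext_isClosed _ _ fun p => by
    change (∃ c, (p.1 = c ∧ True) ∧ Stable f c p.2) ↔ Stable f p.1 p.2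
    simp
  mul_one f := ClosureOperator.ext_isClosed _ _ fun p => by
    change (∃ c, Stable f p.1 c ∧ (c = p.2 ∧ True)) ↔ Stable f p.1 p.2
    simp

/-- Back-flow along `f`: the closure operator whose closed elements form the domain of `f`. -/
def backFlow (f : AbstractFlow L) : ClosureOperator L :=
  ClosureOperator.ofCompletePred (fun a => ∃ b, Stable f a b) (by
    intro s hs
    choose! c hc using hs
    refine ⟨sInf (c '' s), ?_⟩
    have := stable_sInf f ((fun a => (a, c a)) '' s) (by
      rintro _ ⟨p, hp, rfl⟩; exact hc p hp)
    simpa [Prod.fst_sInf, Prod.snd_sInf, Set.image_image] using this)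

/-- Kleene star of `f`: the closure operator whose closed elements are the fixed points of `f`. -/
def star (f : AbstractFlow L) : ClosureOperator L :=
  ClosureOperator.ofCompletePred (fun a => Stable f a a) (by
    intro s hs
    have := stable_sInf f ((fun a => (a, a)) '' s) (by
      rintro _ ⟨p, hp, rfl⟩; exact hs p hp)
    simpa [Prod.fst_sInf, Prod.snd_sInf, Set.image_image] using this)

/-- Forward-flow along `f`. -/
def forwardFlow (f : AbstractFlow L) (a : L) : L := (f (a, ⊥)).2

/-- `f ^ (ω + *) = f ^ ω f *`. -/
noncomputable def omegaStar (f : AbstractFlow L) : AbstractFlow L :=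
  omegaPow f * diag (star f)

/-- The join, in the lattice of closure operators on `L`, of a set of closure operators: an element
is closed under it if and only if it is closed under each member. -/
def joinClosure (C : Set (ClosureOperator L)) : ClosureOperator L :=
  ClosureOperator.ofCompletePred (fun a => ∀ c ∈ C, c.IsClosed a) (by
    intro s hs c hc
    refine c.isClosed_iff_closure_le.2 (le_sInf fun a ha => ?_)
    exact ClosureOperator.closure_min (sInf_le ha) (hs a ha c hc))

/-! ### The flow monoid, the vacuum and the standard interpretation

`Φ x` is free flow along the letter `x`. -/

variable {X : Type v}

/-- The axioms of the `n`-flow monoid; (Identity) and (Products) say that `K` is a submonoid.  In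
(Loops), `f` is an `n`-loopable element of the monoid `K`. -/
structure IsFlowClosed (Φ : X → AbstractFlow L) (n : ℕ) (K : Submonoid (AbstractFlow L)) :
    Prop where
  points : ∀ x, Φ x ∈ K
  vacuum : ∀ f ∈ K, diag (backFlow f) ∈ K
  loops : ∀ f : K, IsLoopable n K f → omegaStar (f : AbstractFlow L) ∈ K

/-- The `n`-flow monoid. -/
def flowMonoid (Φ : X → AbstractFlow L) (n : ℕ) : Submonoid (AbstractFlow L) :=
  sInf {K | IsFlowClosed Φ n K}

/-- The `n`-flow monoid satisfies the axioms, hence is the least submonoid that does. -/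
theorem isFlowClosed_flowMonoid (Φ : X → AbstractFlow L) (n : ℕ) :
    IsFlowClosed Φ n (flowMonoid Φ n) where
  points x := Submonoid.mem_sInf.2 fun _ hK => hK.points x
  vacuum f hf := Submonoid.mem_sInf.2 fun K hK => hK.vacuum f (Submonoid.mem_sInf.1 hf K hK)
  loops := by
    rintro ⟨f, hf⟩ hl
    refine Submonoid.mem_sInf.2 fun K hK => ?_
    have hle : flowMonoid Φ n ≤ K := sInf_le hK
    exact hK.loops ⟨f, hle hf⟩ (IsLoopable.map n (Submonoid.inclusion hle) hl)

/-- The vacuum `F_n`: the join of the back-flows along the elements of the `n`-flow monoid. -/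
def vacuum (Φ : X → AbstractFlow L) (n : ℕ) : ClosureOperator L :=
  joinClosure (backFlow '' (flowMonoid Φ n : Set (AbstractFlow L)))

/-- The letters from which well-formed formulae are built: the elements of `X` and the formal
expressions `τ ^ (ω + *)`. -/
inductive Atom (X : Type v) : Type v
  | letter : X → Atom X
  | omegaStar : List (Atom X) → Atom X

/-- `τ` is a proper power, that is, `τ = σ ^ k` for some `σ` and some `k ≥ 2`. -/
def IsProperPower {Y : Type v} (τ : List Y) : Prop :=
  ∃ (σ : List Y) (k : ℕ), 2 ≤ k ∧ τ = (List.replicate k σ).flatten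

/-- Well-formed formulae, as words over `Atom X`. -/
inductive IsWellFormed : List (Atom X) → Prop
  | empty : IsWellFormed []
  | letter (x : X) : IsWellFormed [Atom.letter x]
  | mul {τ σ : List (Atom X)} : IsWellFormed τ → IsWellFormed σ → IsWellFormed (τ ++ σ)
  | omegaStar {τ : List (Atom X)} : IsWellFormed τ → ¬ IsProperPower τ →
      IsWellFormed [Atom.omegaStar τ]

/-- The standard interpretation, a partial function from well-formed formulae to abstract flows,
given by its graph. -/
inductive Interprets (Φ : X → AbstractFlow L) (n : ℕ) : List (Atom X) → AbstractFlow L → Prop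
  | empty : Interprets Φ n [] (diag (vacuum Φ n))
  | letter (x : X) :
      Interprets Φ n [Atom.letter x] (diag (vacuum Φ n) * Φ x * diag (vacuum Φ n))
  | mul {τ σ : List (Atom X)} {f g : AbstractFlow L} :
      Interprets Φ n τ f → Interprets Φ n σ g → Interprets Φ n (τ ++ σ) (f * g)
  | omegaStar {τ : List (Atom X)} {f : AbstractFlow L} :
      IsWellFormed τ → ¬ IsProperPower τ → Interprets Φ n τ f →
      (∃ h : f ∈ flowMonoid Φ n, IsLoopable n (flowMonoid Φ n) ⟨f, h⟩) →
      Interprets Φ n [Atom.omegaStar τ] (omegaStar f)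

end Flows

/-! ### Set-partitions -/

/-- A pair `(Y, P)` of a subset `Y` of `α` and a partition `P` of `Y`, the latter given as an
equivalence relation on `Y`. -/
@[ext]
structure SetPartition (α : Type u) where
  carrier : Set α
  Rel : α → α → Prop
  mem_of_rel : ∀ {a b}, Rel a b → a ∈ carrier ∧ b ∈ carrier
  refl : ∀ {a}, a ∈ carrier → Rel a a
  symm : ∀ {a b}, Rel a b → Rel b a
  trans : ∀ {a b c}, Rel a b → Rel b c → Rel a c

namespace SetPartition

variable {α : Type u}

instance : PartialOrder (SetPartition α) where
  le p q := p.carrier ⊆ q.carrier ∧ ∀ a b, p.Rel a b → q.Rel a b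
  le_refl _ := ⟨subset_rfl, fun _ _ h => h⟩
  le_trans _ _ _ h k := ⟨h.1.trans k.1, fun a b hab => k.2 a b (h.2 a b hab)⟩
  le_antisymm p q h k := SetPartition.ext (h.1.antisymm k.1)
    (funext fun a => funext fun b => propext ⟨h.2 a b, k.2 a b⟩)

instance : InfSet (SetPartition α) where
  sInf s :=
    { carrier := {a | ∀ p ∈ s, a ∈ p.carrier}
      Rel := fun a b => ∀ p ∈ s, p.Rel a b
      mem_of_rel := fun h => ⟨fun p hp => (p.mem_of_rel (h p hp)).1,
        fun p hp => (p.mem_of_rel (h p hp)).2⟩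
      refl := fun h p hp => p.refl (h p hp)
      symm := fun h p hp => p.symm (h p hp)
      trans := fun h k p hp => p.trans (h p hp) (k p hp) }

/-- The set-partition lattice; its bottom is the empty set with the empty partition. -/
instance : CompleteLattice (SetPartition α) :=
  { completeLatticeOfInf (SetPartition α) fun _ =>
      ⟨fun p hp => ⟨fun _ ha => ha p hp, fun _ _ hab => hab p hp⟩,
        fun _ hq => ⟨fun _ ha _ hp => (hq hp).1 ha, fun a b hab _ hp => (hq hp).2 a b hab⟩⟩ with
    bot :=
      { carrier := ∅
        Rel := fun _ _ => False
        mem_of_rel := fun h => h.elim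
        refl := fun h => h.elim
        symm := fun h => h
        trans := fun h _ => h }
    bot_le := fun _ => ⟨Set.empty_subset _, fun _ _ h => h.elim⟩ }

/-- The point `({r}, {{r}})`. -/
def point (r : α) : SetPartition α where
  carrier := {r}
  Rel a b := a = r ∧ b = r
  mem_of_rel h := h
  refl h := ⟨h, h⟩
  symm h := ⟨h.2, h.1⟩
  trans h k := ⟨h.1, k.2⟩

end SetPartition

/-! ### Group mapping monoids and their set-partition flow lattices -/

section GroupMapping

variable {M : Type u} [Monoid M]

/-- `z` is a zero of `M`. -/
def IsZeroElem (z : M) : Prop := ∀ m : M, m * z = z ∧ z * m = z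

/-- Nonempty two-sided ideals. -/
def IsTwoSidedIdeal (I : Set M) : Prop :=
  I.Nonempty ∧ ∀ a ∈ I, ∀ m : M, m * a ∈ I ∧ a * m ∈ I

/-- `I` is a `0`-minimal ideal: minimal among the ideals different from `{0}`.  (If `M` has no zero,
this means that `I` is the minimal ideal.) -/
def IsZeroMinimalIdeal (I : Set M) : Prop :=
  IsTwoSidedIdeal I ∧ (∃ a ∈ I, ¬ IsZeroElem a) ∧
    ∀ J : Set M, IsTwoSidedIdeal J → J ⊆ I → (∃ a ∈ J, ¬ IsZeroElem a) → J = I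

/-- `I` makes `M` a group mapping monoid: `I` is a `0`-minimal regular ideal of `M` that contains a
non-trivial group, and `M` acts faithfully on the right and on the left of `I`. -/
structure IsGroupMappingIdeal (I : Set M) : Prop where
  zeroMinimal : IsZeroMinimalIdeal I
  regular : ∀ a ∈ I, ∃ b : M, a * b * a = a
  group : ∃ (G : Type u) (_ : Group G) (φ : G →ₙ* M),
    Nontrivial G ∧ Function.Injective φ ∧ ∀ g, φ g ∈ I
  faithful_right : ∀ m m' : M, (∀ a ∈ I, a * m = a * m') → m = m'
  faithful_left : ∀ m m' : M, (∀ a ∈ I, m * a = m' * a) → m = m'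

/-- `R` is the `R`-class of a nonzero element of `I`. -/
def IsDistinguishedRClass (I R : Set M) : Prop :=
  ∃ r ∈ I, ¬ IsZeroElem r ∧ R = {s | RRel r s}

/-- Free flow along `m` on set-partitions of `R`, where `M` acts on the right of `R` by partial
transformations: `(U, P)` flows to `(Y, Q)` if and only if `U m ⊆ Y` and right multiplication by
`m` induces a partial injective map `U / P → Y / Q`. -/
def freeFlow (R : Set M) (m : M) : AbstractFlow (SetPartition R) :=
  ofRel (fun U Y =>
    (∀ a ∈ U.carrier, ∀ ha : (a : M) * m ∈ R, (⟨a * m, ha⟩ : R) ∈ Y.carrier) ∧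
    ∀ a ∈ U.carrier, ∀ b ∈ U.carrier, ∀ (ha : (a : M) * m ∈ R) (hb : (b : M) * m ∈ R),
      (U.Rel a b ↔ Y.Rel ⟨a * m, ha⟩ ⟨b * m, hb⟩)) (by
    intro s hs
    rw [Prod.fst_sInf, Prod.snd_sInf]
    refine ⟨?_, ?_⟩
    · rintro a haU ha _ ⟨p, hp, rfl⟩
      exact (hs p hp).1 a (haU _ ⟨p, hp, rfl⟩) ha
    · intro a haU b hbU ha hb
      constructor
      · rintro h _ ⟨p, hp, rfl⟩
        exact ((hs p hp).2 a (haU _ ⟨p, hp, rfl⟩) b (hbU _ ⟨p, hp, rfl⟩) ha hb).1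
          (h _ ⟨p, hp, rfl⟩)
      · rintro h _ ⟨p, hp, rfl⟩
        exact ((hs p hp).2 a (haU _ ⟨p, hp, rfl⟩) b (hbU _ ⟨p, hp, rfl⟩) ha hb).2
          (h _ ⟨p, hp, rfl⟩))

/-- The `X`-flow lattice structure on set-partitions of `R`, where `M` is generated by the `ι x`. -/
def setPartitionFlow {X : Type v} (ι : X → M) (R : Set M) (x : X) :
    AbstractFlow (SetPartition R) :=
  freeFlow R (ι x)

/-- The `F_n`-states of the set-partition flow lattice. -/
inductive IsFState {X : Type v} (ι : X → M) (R : Set M) (n : ℕ) : SetPartition R → Prop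
  | point (r : R) : IsFState ι R n (SetPartition.point r)
  | forward {ℓ : SetPartition R} {τ : List (Atom X)} {f : AbstractFlow (SetPartition R)} :
      IsFState ι R n ℓ → IsWellFormed τ → Interprets (setPartitionFlow ι R) n τ f →
      IsFState ι R n (forwardFlow f ℓ)
  | order {ℓ ℓ' : SetPartition R} :
      ℓ ≤ ℓ' → IsFState ι R n ℓ' → IsFState ι R n (vacuum (setPartitionFlow ι R) n ℓ)

end GroupMapping

/-! ### Automata, complete flows and inevitability -/

section Automata

/-- Partial transformations of `Q`, composed from left to right. -/
def PartialTransformation (Q : Type u) : Type u := Q → Option Q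

instance (Q : Type u) : Monoid (PartialTransformation Q) where
  mul f g := fun q => (f q).bind g
  one := fun q => some q
  mul_assoc f g h := funext fun q => Option.bind_assoc (f q) g h
  one_mul _ := rfl
  mul_one f := funext fun q => Option.bind_fun_some (f q)

/-- A partial deterministic automaton over `X` with state set `Q`; `step q x` is `q x`, or `none`
if this is undefined. -/
structure PartialAutomaton (Q : Type u) (X : Type v) where
  step : Q → X → Option Q

/-- The transition monoid of a partial automaton. -/
def PartialAutomaton.transitionMonoid {Q : Type u} {X : Type v} (A : PartialAutomaton Q X) :
    Submonoid (PartialTransformation Q) :=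
  Submonoid.closure (Set.range fun (x : X) (q : Q) => A.step q x)

variable {M : Type u} [Monoid M] {X : Type v}

/-- `F` is a complete flow: extended to the completion of `A`, whose sink state `none` it sends to
the bottom, it is a flow, and each point of `R` lies below some value of `F`. -/
structure IsCompleteFlow (ι : X → M) (R : Set M) {Q : Type} (A : PartialAutomaton Q X)
    (F : Q → SetPartition R) : Prop where
  flow : ∀ (p : Option Q) (x : X), Stable (setPartitionFlow ι R x)
    (p.elim ⊥ F) ((p.bind fun q => A.step q x).elim ⊥ F)
  fullyDefined : ∀ r : R, ∃ q, SetPartition.point r ≤ F q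

/-- `ℓ` is `V`-inevitable, for a class `V` of finite monoids. -/
def IsInevitable (V : (N : Type) → [Monoid N] → Prop) (ι : X → M) (R : Set M)
    (ℓ : SetPartition R) : Prop :=
  ∀ (Q : Type) [Finite Q] (A : PartialAutomaton Q X), V A.transitionMonoid →
    ∀ F : Q → SetPartition R, IsCompleteFlow ι R A F → ∃ q, ℓ ≤ F q

end Automata

end FlowBound

namespace FlowBound

universe u v

/-! ### Elements of finite monoids -/

section Elements

/-! Let `F` be a complete flow on an automaton with transition monoid `S` of complexity at most `n`.
Consider the abstract flows `f` for which some `s` in `S` moves every state along a stable pair of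
`f` (`followed`). They form a submonoid containing the letters and the back-flows. If it is also
closed under the loop axiom, it contains the flow monoid and every interpreted formula; the values
of `F` are then closed under the vacuum, and induction on the construction of a state finds a value
of `F` above it.

For the loop axiom, the pairs `(f, s)` form a relational morphism to `S`. If `f` is related to an
`s` with `s ^ (k + 1) = s ^ k`, then iterating `s` ends in states fixed by `s`, whose values are
fixed points of `f`; so a power of `s` follows `f ^ (ω + *)` (`Follows.omegaStar`). Hence everything
rests on `ComplexityLE.exists_isAperiodicElem`: an `n`-loopable element is related to an aperiodic
one.

Each level of loopability is matched with one pair (aperiodic, group) of a wreath product. Type I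
confines the aperiodic coordinate to a monoid in `ER`; a group coordinate above it stays in `ER`
(`Cascade.isER`). A finite monoid in `ER` acts on its regular `R`-classes by partial injections,
which extend to permutations, and an element related to the identity permutation is aperiodic.
Passing to Type II elements therefore makes the group coordinate act aperiodically, and the pair can
be absorbed into the state set (`IsKRProduct.isResolvable_of_cascade`). -/

theorem exists_idempotent_pow {S : Type u} [Monoid S] [Finite S] (a : S) :
    ∃ k : ℕ, 0 < k ∧ IsIdempotentElem (a ^ k) := by
  obtain ⟨i, j, hij, h⟩ := Finite.exists_ne_map_eq_of_infinite fun k : ℕ => a ^ k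
  wlog hlt : i < j generalizing i j
  · exact this j i hij.symm h.symm (by omega)
  obtain ⟨d, rfl⟩ := Nat.exists_eq_add_of_lt hlt
  have h1 : ∀ m, i ≤ m → a ^ (m + (d + 1)) = a ^ m := by
    intro m hm
    obtain ⟨c, rfl⟩ := Nat.exists_eq_add_of_le hm
    rw [pow_add a i c, show a ^ i = a ^ (i + d + 1) from h, ← pow_add]
    congr 1
    omega
  have h2 : ∀ m, i ≤ m → ∀ c : ℕ, a ^ (m + c * (d + 1)) = a ^ m := by
    intro m hm c
    induction c with
    | zero => simp
    | succ c ih =>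
      rw [← ih, ← h1 (m + c * (d + 1)) (by omega)]
      congr 1
      ring
  -- A multiple of the period `d + 1` that is at least `i`; the factor `i + 1` keeps it positive.
  refine ⟨(i + 1) * (d + 1), by positivity, ?_⟩
  change _ * _ = _
  rw [← pow_add]
  exact h2 _ (by nlinarith) _

/-- The element `a` satisfies `a ^ (k + 1) = a ^ k` for some `k`. -/
def IsAperiodicElem {S : Type u} [Monoid S] (a : S) : Prop := ∃ k : ℕ, a ^ (k + 1) = a ^ k

theorem pow_eq_of_le {S : Type u} [Monoid S] {a : S} {k m : ℕ} (h : a ^ (k + 1) = a ^ k)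
    (hm : k ≤ m) : a ^ m = a ^ k := by
  induction m, hm using Nat.le_induction with
  | base => rfl
  | succ m _ ih => rw [pow_succ, ih, ← pow_succ, h]

theorem IsAperiodicElem.map {S : Type u} {T : Type v} [Monoid S] [Monoid T] {a : S}
    (h : IsAperiodicElem a) (f : S →* T) : IsAperiodicElem (f a) := by
  obtain ⟨k, hk⟩ := h
  exact ⟨k, by rw [← map_pow, ← map_pow, hk]⟩

theorem IsAperiodicElem.of_map {S : Type u} {T : Type v} [Monoid S] [Monoid T] {a : S}
    (f : S →* T) (hf : Function.Injective f) (h : IsAperiodicElem (f a)) : IsAperiodicElem a := by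
  obtain ⟨k, hk⟩ := h
  exact ⟨k, hf (by rw [map_pow, map_pow, hk])⟩

theorem RRel.trans {S : Type u} [Monoid S] {a b c : S} (h : RRel a b) (k : RRel b c) :
    RRel a c := by
  obtain ⟨⟨x, rfl⟩, y, hy⟩ := h
  obtain ⟨⟨x', rfl⟩, y', hy'⟩ := k
  exact ⟨⟨x * x', by rw [mul_assoc]⟩, y' * y, by rw [← mul_assoc, hy', hy]⟩

theorem RRel.symm {S : Type u} [Monoid S] {a b : S} (h : RRel a b) : RRel b a := ⟨h.2, h.1⟩

theorem RRel.map {S : Type u} {T : Type v} [Monoid S] [Monoid T] {a b : S} (h : RRel a b)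
    (f : S →* T) : RRel (f a) (f b) := by
  obtain ⟨⟨x, rfl⟩, y, hy⟩ := h
  exact ⟨⟨f x, (map_mul f a x).symm⟩, f y, by rw [← map_mul, hy]⟩

theorem RRel.of_mul_mul {S : Type u} [Monoid S] {a x y : S} (h : RRel a (a * (x * y))) :
    RRel a (a * x) := by
  obtain ⟨z, hz⟩ := h.2
  exact ⟨⟨x, rfl⟩, y * z, by rw [← mul_assoc, mul_assoc a, hz]⟩

/-- `a` is a regular element. -/
def IsRegularElem {S : Type u} [Monoid S] (a : S) : Prop := ∃ b, a * b * a = a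

theorem IsRegularElem.of_rRel {S : Type u} [Monoid S] {a b : S} (ha : IsRegularElem a)
    (h : RRel a b) : IsRegularElem b := by
  obtain ⟨s, hs⟩ := ha
  obtain ⟨⟨x, rfl⟩, y, hy⟩ := h
  refine ⟨y * s, ?_⟩
  calc a * x * (y * s) * (a * x) = (a * x * y) * s * a * x := by simp only [mul_assoc]
    _ = a * x := by rw [hy, hs]

end Elements

/-! ### Monoids in `ER` -/

section ER

variable {V : Type u} [Monoid V]

theorem IsER.eq_of_rRel (hV : IsER V) {a b x y : V}
    (ha : a ∈ Submonoid.closure {e : V | IsIdempotentElem e})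
    (hx : x ∈ Submonoid.closure {e : V | IsIdempotentElem e})
    (hy : y ∈ Submonoid.closure {e : V | IsIdempotentElem e})
    (hb : a * x = b) (h : b * y = a) : a = b := by
  subst hb
  have := hV ⟨a, ha⟩ (⟨a, ha⟩ * ⟨x, hx⟩) ⟨⟨⟨x, hx⟩, rfl⟩, ⟨y, hy⟩, Subtype.ext h⟩
  exact congrArg Subtype.val this

/-- A finite monoid in `ER` acts on each regular `R`-class by partial injective maps. -/
theorem IsER.injective_of_rRel [Finite V] (hV : IsER V) {r r' v : V} (hr : IsRegularElem r)
    (h : RRel r (r * v)) (h' : RRel r' (r' * v)) (he : r * v = r' * v) : r = r' := by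
  have hrr : RRel r r' := h.trans (he ▸ h'.symm)
  obtain ⟨s, hs⟩ := hr.of_rRel hrr
  obtain ⟨⟨a, ha⟩, -⟩ := hrr
  obtain ⟨y, hy⟩ := h.2
  obtain ⟨k, hk, hf⟩ := exists_idempotent_pow (v * y)
  set f := (v * y) ^ k with hfdef
  have hr1 : r * (v * y) = r := by rw [← mul_assoc, hy]
  have hr2 : r' * (v * y) = r := by rw [← mul_assoc, ← he, hy]
  have hrp : ∀ m : ℕ, r * (v * y) ^ m = r := by
    intro m
    induction m with
    | zero => simp
    | succ m ih => rw [pow_succ, ← mul_assoc, ih, hr1]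
  -- The first factor `v * y` sends `r'` to `r`; the remaining ones fix `r`.
  have hr'f : r' * f = r := by
    obtain ⟨m, rfl⟩ := Nat.exists_eq_succ_of_ne_zero hk.ne'
    rw [hfdef, Nat.succ_eq_add_one, pow_succ', ← mul_assoc, hr2, hrp]
  -- The idempotent `s * r'` is fixed on the right by the idempotent `f`.
  have he' : IsIdempotentElem (s * r') := by
    change s * r' * (s * r') = s * r'
    rw [mul_assoc, ← mul_assoc r', hs]
  have hef : s * r' * f * a = s * r' := by
    rw [mul_assoc s, hr'f, mul_assoc, ha]
  have hg : IsIdempotentElem (f * a * (s * r')) := by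
    change f * a * (s * r') * (f * a * (s * r')) = f * a * (s * r')
    calc f * a * (s * r') * (f * a * (s * r'))
        = f * a * (s * r' * f * a) * (s * r') := by simp only [mul_assoc]
      _ = f * a * (s * r') := by rw [hef, mul_assoc, he'.eq]
  -- Both sides are products of idempotents, and the idempotent `f * a * (s * r')` leads from the
  -- right side back to the left, so `ER` identifies them. Multiplying by `r'` on the left gives `r'
  -- = r' * f = r`.
  have key : s * r' = s * r' * f := by
    refine hV.eq_of_rRel (Submonoid.subset_closure he') (Submonoid.subset_closure hf)
      (Submonoid.subset_closure hg) rfl ?_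
    calc s * r' * f * (f * a * (s * r')) = s * r' * (f * f) * a * (s * r') := by
          simp only [mul_assoc]
      _ = s * r' := by rw [hf.eq, hef, he'.eq]
  calc r = r' * f := hr'f.symm
    _ = r' * s * r' * f := by rw [hs]
    _ = r' * (s * r' * f) := by simp only [mul_assoc]
    _ = r' := by rw [← key, ← mul_assoc, hs]

variable (V) in
/-- The relation between `V` and the permutations of `V` that extend the partial action on the
regular `R`-classes. -/
def permRelation : Submonoid (V × (Equiv.Perm V)ᵐᵒᵖ) where
  carrier := {p | ∀ r, IsRegularElem r → RRel r (r * p.1) → p.2.unop r = r * p.1}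
  one_mem' := fun r _ _ => by simp
  mul_mem' := by
    rintro ⟨v, π⟩ ⟨v', π'⟩ h h' r hr hrv
    simp only [Set.mem_ofPred_eq, Prod.mk_mul_mk, MulOpposite.unop_mul, Equiv.Perm.mul_apply]
      at h h' hrv ⊢
    have h1 : RRel r (r * v) := hrv.of_mul_mul
    rw [h r hr h1, h' _ (hr.of_rRel h1) (by simpa only [mul_assoc] using h1.symm.trans hrv),
      mul_assoc]

/-- A partial injection of a finite set extends to a permutation. The opposite group appears because
`V` acts on the right, while permutations compose as left maps. -/
theorem IsER.isRelationalMorphism_permRelation [Finite V] (hV : IsER V) :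
    IsRelationalMorphism (permRelation V) := by
  classical
  intro v
  have := Fintype.ofFinite V
  let D : Set V := {r | IsRegularElem r ∧ RRel r (r * v)}
  have hD : Set.InjOn (· * v) D := fun r hr r' hr' h => hV.injective_of_rRel hr.1 hr.2 hr'.2 h
  let e : {r // r ∈ D} ≃ {r // r ∈ (· * v) '' D} := Equiv.Set.imageOfInjOn _ D hD
  refine ⟨MulOpposite.op e.extendSubtype, fun r hr hrv => ?_⟩
  exact e.extendSubtype_apply_of_mem r ⟨hr, hrv⟩

/-- An idempotent power `v ^ k` is regular and `R`-related to `v ^ k * v`, so the identity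
permutation must send it to `v ^ (k + 1)`. -/
theorem isAperiodicElem_of_mem_permRelation [Finite V] {v : V} (h : (v, 1) ∈ permRelation V) :
    IsAperiodicElem v := by
  obtain ⟨k, hk, he⟩ := exists_idempotent_pow v
  refine ⟨k, ?_⟩
  have := h (v ^ k) ⟨1, by rw [mul_one, he.eq]⟩ ⟨⟨v, rfl⟩, v ^ (k - 1), by
    rw [mul_assoc, ← pow_succ', Nat.sub_add_cancel hk, he.eq]⟩
  rw [pow_succ]
  simpa using this.symm

end ER

/-! ### Loopable elements and complexity -/

section Resolvable

/-- The elements related to the identity element. -/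
def kernel {S : Type u} {H : Type v} [Monoid S] [Monoid H] (ψ : Submonoid (S × H)) :
    Submonoid S := ψ.comap (MonoidHom.inl S H)

/-- `W` can be reduced to an aperiodic monoid in `n` rounds, each of which consists of passing to
the inverse image of a submonoid in `ER` of an aperiodic image, and then to the inverse image of `1`
under a relational morphism to a finite group. -/
def IsResolvable : ℕ → (W : Type) → [Monoid W] → Prop
  | 0, W, _ => IsAperiodic W
  | n + 1, W, _ => IsAperiodic W ∨ ∃ (A : Type) (_ : Monoid A) (_ : Finite A) (p : W →* A),
      IsAperiodic A ∧ ∀ N : Submonoid A, IsER N →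
        ∃ (H : Type) (_ : Group H) (_ : Finite H) (ψ : Submonoid (N.comap p × H)),
          IsRelationalMorphism ψ ∧ IsResolvable n (kernel ψ)

theorem IsAperiodic.isResolvable {W : Type} [Monoid W] (h : IsAperiodic W) (n : ℕ) :
    IsResolvable n W := by
  cases n with
  | zero => exact h
  | succ n => exact Or.inl h

/-- Under a relational morphism to an `n`-resolvable monoid, each `n`-loopable element is related
to an aperiodic element. -/
theorem IsResolvable.exists_isAperiodicElem {n : ℕ} : ∀ {W : Type} [Monoid W],
    IsResolvable n W → ∀ {K : Type u} [Monoid K] {φ : Submonoid (K × W)},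
      IsRelationalMorphism φ → ∀ {t : K}, IsLoopable n K t → ∃ w, (t, w) ∈ φ ∧ IsAperiodicElem w := by
  induction n with
  | zero =>
    intro W _ hW K _ φ hφ t _
    obtain ⟨w, hw⟩ := hφ t
    exact ⟨w, hw, hW w⟩
  | succ n ih =>
    rintro W _ (hW | ⟨A, _, _, p, hA, hp⟩) K _ φ hφ t ht
    · obtain ⟨w, hw⟩ := hφ t
      exact ⟨w, hw, hW w⟩
    obtain ⟨T, hT, t, rfl, ht⟩ := ht
    -- Type I is applied to `φ` followed by `p`: every element of `T` is `φ`-related to some `w`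
    -- with `p w` in `N`.
    obtain ⟨N, hN, hTN⟩ := hT A hA (φ.map ((MonoidHom.id K).prodMap p)) fun s =>
      let ⟨w, hw⟩ := hφ s
      ⟨p w, (s, w), hw, rfl⟩
    obtain ⟨H, _, _, ψ, hψ, hres⟩ := hp N hN
    have hφT : ∀ s : T, ∃ w : N.comap p, ((s : K), (w : W)) ∈ φ := by
      intro s
      obtain ⟨a, haN, ⟨s', w⟩, hw, h⟩ := hTN s s.2
      obtain ⟨h1, h2⟩ := Prod.ext_iff.1 h
      exact ⟨⟨w, show p w ∈ N from (show p w = a from h2) ▸ haN⟩, (show s' = (s : K) from h1) ▸ hw⟩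
    -- The composite of `φ`, restricted to `T`, with `ψ`. A Type II element of `T` is `χ`-related to
    -- `1`, hence `φ`-related to an element of `kernel ψ`, where the induction hypothesis applies.
    let χ : Submonoid (T × H) :=
      { carrier := {q | ∃ w : N.comap p, ((q.1 : K), (w : W)) ∈ φ ∧ (w, q.2) ∈ ψ}
        one_mem' := ⟨1, φ.one_mem, ψ.one_mem⟩
        mul_mem' := by
          rintro q q' ⟨w, h1, h2⟩ ⟨w', h1', h2'⟩
          exact ⟨w * w', φ.mul_mem h1 h1', ψ.mul_mem h2 h2'⟩ }
    have hχ : IsRelationalMorphism χ := fun s =>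
      let ⟨w, hw⟩ := hφT s
      let ⟨g, hg⟩ := hψ w
      ⟨g, w, hw, hg⟩
    let φ' : Submonoid (typeII T × kernel ψ) :=
      φ.comap ((T.subtype.comp (typeII T).subtype).prodMap
        ((N.comap p).subtype.comp (kernel ψ).subtype))
    have hφ' : IsRelationalMorphism φ' := fun s =>
      let ⟨w, hw, hwψ⟩ := s.2 H χ hχ
      ⟨⟨w, hwψ⟩, hw⟩
    obtain ⟨w, hw, hap⟩ := ih hres hφ' ht
    exact ⟨w, hw, hap.map ((N.comap p).subtype.comp (kernel ψ).subtype)⟩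

end Resolvable

/-! ### Cascades -/

/-- The wreath product of `U` with the monoid of all transformations of `Ω`. -/
@[ext]
structure Cascade (U : Type u) (Ω : Type v) where
  out : Ω → U
  next : Ω → Ω

namespace Cascade

instance (U : Type u) (Ω : Type v) [Monoid U] : Monoid (Cascade U Ω) where
  mul s t := ⟨fun ω => s.out ω * t.out (s.next ω), fun ω => t.next (s.next ω)⟩
  one := ⟨fun _ => 1, fun ω => ω⟩
  mul_assoc s t r := Cascade.ext (funext fun _ => mul_assoc _ _ _) rfl
  one_mul s := Cascade.ext (funext fun _ => one_mul _) rfl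
  mul_one s := Cascade.ext (funext fun _ => mul_one _) rfl

instance (U : Type u) (Ω : Type v) [Finite U] [Finite Ω] : Finite (Cascade U Ω) :=
  Finite.of_injective (fun s => (s.out, s.next)) fun _ _ h =>
    Cascade.ext (Prod.ext_iff.1 h).1 (Prod.ext_iff.1 h).2

variable {U : Type u} {Ω : Type v} [Monoid U]

@[simp] theorem out_one (ω : Ω) : (1 : Cascade U Ω).out ω = 1 := rfl
@[simp] theorem next_one (ω : Ω) : (1 : Cascade U Ω).next ω = ω := rfl
@[simp] theorem out_mul (s t : Cascade U Ω) (ω : Ω) :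
    (s * t).out ω = s.out ω * t.out (s.next ω) := rfl
@[simp] theorem next_mul (s t : Cascade U Ω) (ω : Ω) :
    (s * t).next ω = t.next (s.next ω) := rfl

/-- Apply a homomorphism to the outputs. -/
def map {U' : Type*} [Monoid U'] (f : U →* U') : Cascade U Ω →* Cascade U' Ω where
  toFun s := ⟨fun ω => f (s.out ω), s.next⟩
  map_one' := Cascade.ext (funext fun _ => map_one f) rfl
  map_mul' _ _ := Cascade.ext (funext fun _ => map_mul f _ _) rfl

/-- The action on `Ω`. -/
def trans : Cascade U Ω →* Cascade Unit Ω := map 1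

theorem trans_eq_iff {s t : Cascade U Ω} : trans s = trans t ↔ s.next = t.next :=
  ⟨fun h => (congrArg (next (U := Unit)) h :), fun h => Cascade.ext rfl h⟩

theorem out_pow_of_fixed {s : Cascade U Ω} {ω : Ω} (h : s.next ω = ω) (k : ℕ) :
    (s ^ k).out ω = s.out ω ^ k := by
  induction k with
  | zero => simp
  | succ k ih => rw [pow_succ', out_mul, h, ih, pow_succ']

/-- After enough steps every point of `Ω` has reached a fixed point of `s`; from there on the
outputs are the powers of one element of `U`, which stabilize. -/
theorem isAperiodicElem [Finite Ω] (hU : IsAperiodic U) {s : Cascade U Ω}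
    (hs : IsAperiodicElem (trans s)) : IsAperiodicElem s := by
  obtain ⟨k, hk⟩ := hs
  rw [← map_pow, ← map_pow, trans_eq_iff] at hk
  choose m hm using fun ω => hU (s.out ω)
  obtain ⟨J, hJ⟩ := (Set.finite_range m).bddAbove
  have hJ' : ∀ ω, s.out ω ^ (J + 1) = s.out ω ^ J := fun ω => by
    have h := hJ ⟨ω, rfl⟩
    rw [pow_eq_of_le (hm ω) h, pow_eq_of_le (hm ω) (h.trans J.le_succ)]
  refine ⟨k + J, Cascade.ext (funext fun ω => ?_) ?_⟩
  · have hfix : s.next ((s ^ k).next ω) = (s ^ k).next ω := by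
      rw [← next_mul, ← pow_succ, hk]
    rw [add_assoc, pow_add s k, pow_add s k, out_mul, out_mul, out_pow_of_fixed hfix,
      out_pow_of_fixed hfix, hJ']
  · rw [← trans_eq_iff, map_pow, map_pow]
    have hk' : trans s ^ (k + 1) = trans s ^ k := by
      rw [← map_pow, ← map_pow, trans_eq_iff, hk]
    rw [pow_eq_of_le hk' (show k ≤ k + J + 1 by omega), pow_eq_of_le hk' (show k ≤ k + J by omega)]

section Flatten

variable {W : Type*} [Monoid W]

/-- The action of a cascade with outputs in `W` on `W × Ω`. -/
def act : Cascade W Ω →* Cascade Unit (W × Ω) where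
  toFun s := ⟨fun _ => 1, fun p => (p.1 * s.out p.2, s.next p.2)⟩
  map_one' := Cascade.ext rfl (funext fun _ => Prod.ext (mul_one _) rfl)
  map_mul' _ _ := Cascade.ext rfl (funext fun _ => Prod.ext (mul_assoc _ _ _).symm rfl)

theorem act_injective : Function.Injective (act : Cascade W Ω → Cascade Unit (W × Ω)) := by
  intro s t h
  have h' := fun ω => congrFun (congrArg Cascade.next h) (1, ω)
  refine Cascade.ext (funext fun ω => ?_) (funext fun ω => (Prod.ext_iff.1 (h' ω)).2)
  -- Acting on the first coordinate `1` reads off the output.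
  simpa [act] using (Prod.ext_iff.1 (h' ω)).1

variable (U W) in
/-- The projection of a wreath product. -/
def _root_.FlowBound.Wreath.topHom : Wreath U W →* W where
  toFun p := p.top
  map_one' := rfl
  map_mul' _ _ := rfl

/-- Cascades with outputs in a wreath product, as cascades with outputs in its first factor. -/
def flatten : Cascade (Wreath U W) Ω →* Cascade U (W × Ω) where
  toFun s := ⟨fun p => (s.out p.2).base p.1, fun p => (p.1 * (s.out p.2).top, s.next p.2)⟩
  map_one' := Cascade.ext rfl (funext fun _ => Prod.ext (mul_one _) rfl)
  map_mul' _ _ := Cascade.ext rfl (funext fun _ => Prod.ext (mul_assoc _ _ _).symm rfl)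

/-- The action of the flattened cascade depends only on the top factor of the outputs, so
aperiodicity of that part suffices for it. -/
theorem trans_flatten (s : Cascade (Wreath U W) Ω) :
    trans (flatten s) = act (map (Wreath.topHom U W) s) := rfl

theorem flatten_injective :
    Function.Injective (flatten : Cascade (Wreath U W) Ω → Cascade U (W × Ω)) := by
  intro s t h
  have h1 : map (Wreath.topHom U W) s = map (Wreath.topHom U W) t :=
    act_injective (by rw [← trans_flatten, ← trans_flatten, h])
  refine Cascade.ext (funext fun ω => Wreath.ext (funext fun x => ?_) ?_)
    (congrArg (next (U := W)) h1 :)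
  · exact congrFun (congrArg Cascade.out h) (x, ω)
  · exact congrFun (congrArg Cascade.out h1) ω

end Flatten

/-- Cascades with outputs in a group over a monoid of transformations in `ER` belong to `ER`. -/
theorem isER {V N G : Type*} [Monoid V] [Monoid N] [Group G] (j : V →* Cascade G Ω)
    (hj : Function.Injective j) (τ : V →* N) (hN : IsER N)
    (hτ : ∀ v w, τ v = τ w → (j v).next = (j w).next) : IsER V := by
  have hmem : ∀ v ∈ Submonoid.closure {e : V | IsIdempotentElem e},
      τ v ∈ Submonoid.closure {e : N | IsIdempotentElem e} := by
    intro v hv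
    have : Submonoid.closure {e : V | IsIdempotentElem e} ≤
        (Submonoid.closure {e : N | IsIdempotentElem e}).comap τ :=
      Submonoid.closure_le.2 fun e he => Submonoid.subset_closure (IsIdempotentElem.map he τ)
    exact this hv
  -- A product of idempotents that returns `τ a` to itself outputs `1` on the image of `a`: an
  -- idempotent outputs an idempotent of `G` at a point it fixes, and that is `1`.
  have key : ∀ x ∈ Submonoid.closure {e : V | IsIdempotentElem e},
      ∀ a ∈ Submonoid.closure {e : V | IsIdempotentElem e},
        τ (a * x) = τ a → ∀ ω, (j x).out ((j a).next ω) = 1 := by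
    intro x hx
    induction hx using Submonoid.closure_induction with
    | one => simp
    | mem e he =>
      intro a _ h ω
      have h1 : (j e).next ((j a).next ω) = (j a).next ω := by
        rw [← next_mul, ← map_mul, hτ _ _ h]
      have h2 := congrFun (congrArg out (IsIdempotentElem.map he j).eq) ((j a).next ω)
      rwa [out_mul, h1, mul_eq_left] at h2
    | mul x y hx hy ihx ihy =>
      intro a ha h ω
      -- As `y` brings `τ (a * x)` back to `τ a`, the hypothesis on `N` shows that `x` alone already
      -- fixes `τ a`; so the claim splits over the factors.
      have h1 : τ (a * x) = τ a := by
        refine (hN.eq_of_rRel (hmem a ha) (hmem x hx) (hmem y hy) (map_mul τ a x).symm ?_).symm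
        rw [← map_mul, mul_assoc, h]
      have h2 := ihy (a * x) (mul_mem ha hx) (by rw [mul_assoc, h, h1]) ω
      rw [map_mul, next_mul] at h2
      rw [map_mul, out_mul, ihx a ha h1, h2, mul_one]
  rintro ⟨a, ha⟩ b ⟨⟨⟨x, hx⟩, hb⟩, ⟨y, hy⟩, h⟩
  subst hb
  have h : a * x * y = a := congrArg Subtype.val h
  have h1 : τ a = τ (a * x) := by
    refine hN.eq_of_rRel (hmem a ha) (hmem x hx) (hmem y hy) (map_mul τ a x).symm ?_
    rw [← map_mul, h]
  refine Subtype.ext (hj (Cascade.ext (funext fun ω => ?_) (hτ _ _ h1)))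
  change (j a).out ω = (j (a * x)).out ω
  rw [map_mul, out_mul, key x hx a ha h1.symm, mul_one]

end Cascade

/-- Monoids of cascades with outputs in a product of `m` groups and `m + 1` aperiodic monoids, and
with aperiodic actions, are `n`-resolvable for `m ≤ n`. -/
theorem IsKRProduct.isResolvable_of_cascade {m : ℕ} {U : Type} {instU : Monoid U}
    (h : IsKRProduct m U instU) : ∀ n, m ≤ n → ∀ (Ω : Type) [Finite Ω] (S : Type) [Monoid S]
      (j : S →* Cascade U Ω), Function.Injective j →
        (∀ s, IsAperiodicElem (Cascade.trans (j s))) → IsResolvable n S := by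
  induction h with
  | aperiodic A hA =>
    intro n _ Ω _ S _ j hj hs
    exact IsAperiodic.isResolvable
      (fun s => (Cascade.isAperiodicElem hA (hs s)).of_map j hj) n
  | step m U G A hU hA ih =>
    rintro (_ | n) hmn Ω _ S _ j hj hs
    · omega
    -- The outer aperiodic factor `A` joins the state set: `p₀` is the action on `A × Ω`, and its
    -- image is the aperiodic monoid of this round.
    let p₀ : S →* Cascade Unit (A × Ω) := Cascade.trans.comp (Cascade.flatten.comp j)
    have hp₀ : ∀ s, IsAperiodicElem (p₀ s) := fun s => by
      change IsAperiodicElem (Cascade.act (Cascade.map (Wreath.topHom (Wreath U G) A) (j s)))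
      exact (Cascade.isAperiodicElem hA (hs s)).map _
    let p : S →* MonoidHom.mrange p₀ := p₀.mrangeRestrict
    refine Or.inr ⟨MonoidHom.mrange p₀, inferInstance, inferInstance, p, ?_, fun N hN => ?_⟩
    · rintro ⟨_, s, rfl⟩
      exact (hp₀ s).of_map (MonoidHom.mrange p₀).subtype Subtype.val_injective
    -- The group part of the outputs, as a cascade over `A × Ω`.
    let c : S →* Cascade G (A × Ω) :=
      (Cascade.map (Wreath.topHom U G)).comp (Cascade.flatten.comp j)
    let ν : N →* Cascade Unit (A × Ω) := (MonoidHom.mrange p₀).subtype.comp N.subtype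
    have hν : Function.Injective ν := Subtype.val_injective.comp Subtype.val_injective
    -- The pairs of a `G`-cascade and an element of `N` with the same action on `A × Ω`.
    let V : Submonoid (Cascade G (A × Ω) × N) :=
      MonoidHom.eqLocusM (Cascade.trans.comp (MonoidHom.fst _ _)) (ν.comp (MonoidHom.snd _ _))
    let ρ : N.comap p →* V :=
      ((c.comp (N.comap p).subtype).prod (p.submonoidComap N)).codRestrict V fun _ => rfl
    let j' : V →* Cascade G (A × Ω) := (MonoidHom.fst _ _).comp V.subtype
    let τ : V →* N := (MonoidHom.snd _ _).comp V.subtype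
    have hV' : ∀ v : V, Cascade.trans (j' v) = ν (τ v) := fun v => v.2
    have hV : IsER V := by
      refine Cascade.isER j' (fun v w h => Subtype.ext (Prod.ext h (hν ?_))) τ hN fun v w h => ?_
      · exact (hV' v).symm.trans ((congrArg Cascade.trans h).trans (hV' w))
      · rw [← Cascade.trans_eq_iff, hV', hV', h]
    have : Finite V := inferInstance
    let ψ : Submonoid (N.comap p × (Equiv.Perm V)ᵐᵒᵖ) :=
      (permRelation V).comap (ρ.prodMap (MonoidHom.id _))
    refine ⟨(Equiv.Perm V)ᵐᵒᵖ, inferInstance, Finite.of_equiv _ MulOpposite.opEquiv, ψ, fun s => ?_, ?_⟩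
    · exact hV.isRelationalMorphism_permRelation (ρ s)
    -- On `kernel ψ` the action on `G × (A × Ω)` is aperiodic, since it is determined by the image
    -- in `V`; the factor `G` is absorbed as well and only outputs in `U` remain.
    refine ih n (by omega) (G × (A × Ω)) (kernel ψ)
      (Cascade.flatten.comp (Cascade.flatten.comp
        (j.comp ((N.comap p).subtype.comp (kernel ψ).subtype)))) ?_ fun s => ?_
    · exact Cascade.flatten_injective.comp (Cascade.flatten_injective.comp
        (hj.comp (Subtype.val_injective.comp Subtype.val_injective)))
    · have h : IsAperiodicElem (ρ s.1) := isAperiodicElem_of_mem_permRelation s.2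
      exact h.map (Cascade.act.comp j')

theorem IsKRProduct.isResolvable {m n : ℕ} {W : Type} {instW : Monoid W}
    (h : IsKRProduct m W instW) (hmn : m ≤ n) : IsResolvable n W := by
  -- Over a one-point state set the action is trivial, hence aperiodic.
  let j : W →* Cascade W Unit :=
    { toFun := fun w => ⟨fun _ => w, id⟩
      map_one' := rfl
      map_mul' := fun _ _ => rfl }
  exact h.isResolvable_of_cascade n hmn Unit W j
    (fun _ _ h => congrFun (congrArg Cascade.out h) ()) fun _ => ⟨0, rfl⟩

/-- Under a relational morphism to a monoid of complexity at most `n`, each `n`-loopable element is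
related to an aperiodic element. -/
theorem ComplexityLE.exists_isAperiodicElem {n : ℕ} {S : Type} [Monoid S] (h : ComplexityLE n S)
    {K : Type u} [Monoid K] {φ : Submonoid (K × S)} (hφ : IsRelationalMorphism φ) {t : K}
    (ht : IsLoopable n K t) : ∃ s, (t, s) ∈ φ ∧ IsAperiodicElem s := by
  obtain ⟨m, hm, W, instW, hW, T, f, hf⟩ := h
  -- The relation is lifted through the division, with values in `T`; an aperiodic `w` in `T` then
  -- maps to an aperiodic element of `S`.
  let φ' : Submonoid (K × W) :=
    (φ.comap ((MonoidHom.id K).prodMap f)).map ((MonoidHom.id K).prodMap T.subtype)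
  have hφ' : IsRelationalMorphism φ' := fun k => by
    obtain ⟨s, hs⟩ := hφ k
    obtain ⟨w, rfl⟩ := hf s
    exact ⟨w, (k, w), hs, rfl⟩
  obtain ⟨w, ⟨⟨k, w'⟩, hw, hkw⟩, hap⟩ := (hW.isResolvable hm).exists_isAperiodicElem hφ' ht
  obtain ⟨h1, h2⟩ := Prod.ext_iff.1 hkw
  have hap' : IsAperiodicElem w' := by
    refine IsAperiodicElem.of_map T.subtype Subtype.val_injective ?_
    exact (show T.subtype w' = w from h2) ▸ hap
  exact ⟨f w', (show k = t from h1) ▸ hw, hap'.map f⟩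

/-! ### Complete flows -/

section CompleteFlows

instance {α : Type u} [Finite α] : Finite (SetPartition α) :=
  Finite.of_injective (fun p : SetPartition α => (p.carrier, p.Rel)) fun _ _ h =>
    SetPartition.ext (Prod.ext_iff.1 h).1 (Prod.ext_iff.1 h).2

instance {α : Type u} [PartialOrder α] [Finite α] : Finite (ClosureOperator α) :=
  Finite.of_injective (fun c a => c a) DFunLike.coe_injective

variable {L : Type u} [CompleteLattice L]

theorem isIdempotentElem_omegaPow {S : Type u} [Monoid S] [Finite S] (s : S) :
    ∃ k : ℕ, 0 < k ∧ omegaPow s = s ^ k ∧ IsIdempotentElem (s ^ k) := by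
  have h := Nat.sInf_mem (s := {k : ℕ | 0 < k ∧ IsIdempotentElem (s ^ k)})
    (exists_idempotent_pow s)
  exact ⟨_, h.1, rfl, h.2⟩

theorem stable_one (a : L) : Stable (1 : AbstractFlow L) a a := ⟨rfl, trivial⟩

theorem stable_mul {f g : AbstractFlow L} {a b c : L} (h : Stable f a b) (k : Stable g b c) :
    Stable (f * g) a c := ⟨b, h, k⟩

theorem stable_diag {c : ClosureOperator L} {a : L} (h : c.IsClosed a) : Stable (diag c) a a :=
  ⟨rfl, h⟩

theorem isClosed_backFlow {f : AbstractFlow L} {a b : L} (h : Stable f a b) :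
    (backFlow f).IsClosed a := ⟨b, h⟩

theorem stable_diag_star {f : AbstractFlow L} {a : L} (h : Stable f a a) :
    Stable (diag (star f)) a a := ⟨rfl, h⟩

theorem forwardFlow_le {f : AbstractFlow L} {a b c : L} (h : Stable f b c) (hab : a ≤ b) :
    forwardFlow f a ≤ c :=
  (ClosureOperator.closure_min (show (a, ⊥) ≤ (b, c) from ⟨hab, bot_le⟩) h).2

variable {Q : Type}

/-- The extension of `F` to the completion of the automaton. -/
def extendBot (F : Q → L) (p : Option Q) : L := p.elim ⊥ F

/-- The states flow along `f` as the partial transformation `s` moves them. -/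
def Follows (F : Q → L) (f : AbstractFlow L) (s : PartialTransformation Q) : Prop :=
  ∀ p : Option Q, Stable f (extendBot F p) (extendBot F (p.bind s))

variable {F : Q → L} {f g : AbstractFlow L} {s t : PartialTransformation Q}

theorem follows_one : Follows F 1 1 := fun p => by
  rw [show p.bind (1 : PartialTransformation Q) = p by cases p <;> rfl]
  exact stable_one _

theorem Follows.mul (h : Follows F f s) (k : Follows F g t) : Follows F (f * g) (s * t) :=
  fun p => by
    rw [show p.bind (s * t) = (p.bind s).bind t from (Option.bind_assoc p s t).symm]
    exact stable_mul (h p) (k _)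

theorem Follows.pow (h : Follows F f s) (k : ℕ) : Follows F (f ^ k) (s ^ k) := by
  induction k with
  | zero => simpa using follows_one
  | succ k ih => rw [pow_succ, pow_succ]; exact ih.mul h

theorem follows_diag {c : ClosureOperator L} (h : ∀ p, c.IsClosed (extendBot F p)) :
    Follows F (diag c) 1 := fun p => by
  rw [show p.bind (1 : PartialTransformation Q) = p by cases p <;> rfl]
  exact stable_diag (h p)

/-- A high power of `s` takes every state, the sink included, to one fixed by `s`. There `f` is
followed from a value to itself, so the value is closed under `star f`. -/
theorem Follows.omegaStar [Finite L] (h : Follows F f s) (hs : IsAperiodicElem s) :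
    ∃ k : ℕ, Follows F (omegaStar f) (s ^ k) := by
  obtain ⟨k, hk⟩ := hs
  obtain ⟨m, hm, hω, hid⟩ := isIdempotentElem_omegaPow f
  have hkm : s ^ (m * (k + 1) + 1) = s ^ (m * (k + 1)) := by
    have : k ≤ m * (k + 1) := by nlinarith
    rw [pow_eq_of_le hk this, pow_eq_of_le hk (this.trans (Nat.le_succ _))]
  have hpow : omegaPow f = f ^ (m * (k + 1)) := by rw [hω, pow_mul, hid.pow_succ_eq]
  -- The exponent is a positive multiple of `m`, so that `f` raised to it is `f ^ ω`, and it is at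
  -- least `k`, so that `s` has stabilized.
  refine ⟨m * (k + 1), fun p => stable_mul ?_ (stable_diag_star (f := f) ?_)⟩
  · rw [hpow]
    exact h.pow _ p
  · have := h (p.bind (s ^ (m * (k + 1))))
    rwa [show (p.bind (s ^ (m * (k + 1)))).bind s = p.bind (s ^ (m * (k + 1))) from by
      conv_rhs => rw [← hkm, pow_succ]
      exact Option.bind_assoc p _ s] at this

variable (F) in
/-- The abstract flows that are followed along some element of `S`. -/
def followed (S : Submonoid (PartialTransformation Q)) : Submonoid (AbstractFlow L) where
  carrier := {f | ∃ s ∈ S, Follows F f s}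
  one_mem' := ⟨1, S.one_mem, follows_one⟩
  mul_mem' := fun ⟨s, hs, h⟩ ⟨t, ht, k⟩ => ⟨s * t, S.mul_mem hs ht, h.mul k⟩

variable {S : Submonoid (PartialTransformation Q)} {X : Type v} {Φ : X → AbstractFlow L} {n : ℕ}

theorem diag_mem_followed {c : ClosureOperator L} (h : ∀ p, c.IsClosed (extendBot F p)) :
    diag c ∈ followed F S := ⟨1, S.one_mem, follows_diag h⟩

/-- Only the loops use the complexity bound. Every value of `F` lies in the domain of a followed
flow, so back-flows are followed by the identity. -/
theorem isFlowClosed_followed [Finite L] (hS : ComplexityLE n S)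
    (hΦ : ∀ x, Φ x ∈ followed F S) : IsFlowClosed Φ n (followed F S) where
  points := hΦ
  vacuum := fun _ ⟨_, _, h⟩ => diag_mem_followed fun p => isClosed_backFlow (h p)
  loops := by
    intro f hf
    -- Loopability is taken inside `followed F S`, and "is followed along" is a relational morphism
    -- from that monoid to `S`.
    let φ : Submonoid (followed F S × S) :=
      { carrier := {q | Follows F (q.1 : AbstractFlow L) (q.2 : PartialTransformation Q)}
        one_mem' := follows_one
        mul_mem' := fun h k => Follows.mul h k }
    have hφ : IsRelationalMorphism φ := fun g =>
      let ⟨s, hs, h⟩ := g.2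
      ⟨⟨s, hs⟩, h⟩
    obtain ⟨s, hs, hap⟩ := hS.exists_isAperiodicElem hφ hf
    obtain ⟨k, hk⟩ := Follows.omegaStar hs (hap.map S.subtype)
    exact ⟨_, S.pow_mem s.2 k, hk⟩

theorem isClosed_vacuum (h : flowMonoid Φ n ≤ followed F S) (p : Option Q) :
    (vacuum Φ n).IsClosed (extendBot F p) := by
  rintro _ ⟨f, hf, rfl⟩
  obtain ⟨s, -, hs⟩ := h hf
  exact isClosed_backFlow (hs p)

/-- The vacuum need not be shown to lie in the flow monoid: the identity follows it because all
values of `F` are closed under it. -/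
theorem Interprets.mem_followed (h : flowMonoid Φ n ≤ followed F S) {τ : List (Atom X)}
    (hτ : Interprets Φ n τ f) : f ∈ followed F S := by
  have hv : diag (FlowBound.vacuum Φ n) ∈ followed F S := diag_mem_followed (isClosed_vacuum h)
  induction hτ with
  | empty => exact hv
  | letter x =>
    exact mul_mem (mul_mem hv (h ((isFlowClosed_flowMonoid Φ n).points x))) hv
  | mul _ _ ih ih' => exact mul_mem ih ih'
  | omegaStar _ _ _ hf _ =>
    obtain ⟨hf, hl⟩ := hf
    exact h ((isFlowClosed_flowMonoid Φ n).loops ⟨_, hf⟩ hl)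

end CompleteFlows

/-- By induction on the state: if `ℓ ≤ F q` and `s` follows `f`, then the forward-flow of `ℓ` lies
below the value at `q s`, because `(F q, F (q s))` is a stable pair of `f`. -/
theorem IsFState.isInevitable {M : Type u} [Monoid M] [Finite M] {X : Type v} {ι : X → M}
    {R : Set M} {n : ℕ} {ℓ : SetPartition R} (hℓ : IsFState ι R n ℓ) :
    IsInevitable (fun N _ => ComplexityLE n N) ι R ℓ := by
  intro Q _ A hA F hF
  have hle : flowMonoid (setPartitionFlow ι R) n ≤ followed F A.transitionMonoid :=
    sInf_le (isFlowClosed_followed hA fun x =>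
      ⟨_, Submonoid.subset_closure ⟨x, rfl⟩, fun p => hF.flow p x⟩)
  induction hℓ with
  | point r => exact hF.fullyDefined r
  | forward _ _ hf ih =>
    obtain ⟨q, hq⟩ := ih
    obtain ⟨s, -, hs⟩ := hf.mem_followed hle
    have h := forwardFlow_le (hs (some q)) hq
    change _ ≤ extendBot F (s q) at h
    cases hsq : s q with
    | none =>
      rw [hsq] at h
      -- The sink has value `⊥`, so the forward-flow is `⊥` and any state serves.
      exact ⟨q, h.trans bot_le⟩
    | some q' =>
      rw [hsq] at h
      exact ⟨q', h⟩
  | order hle' _ ih =>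
    obtain ⟨q, hq⟩ := ih
    exact ⟨q, ClosureOperator.closure_min (hle'.trans hq) (isClosed_vacuum hle (some q))⟩

end FlowBound

theorem mainTheorem2 {M : Type*} [Monoid M] [Finite M] {X : Type*} [Finite X]
    (ι : X → M) (hι : Submonoid.closure (Set.range ι) = ⊤)
    (I : Set M) (hI : FlowBound.IsGroupMappingIdeal I)
    (R : Set M) (hR : FlowBound.IsDistinguishedRClass I R)
    (n : ℕ) (ℓ : FlowBound.SetPartition R) (hℓ : FlowBound.IsFState ι R n ℓ) :
    FlowBound.IsInevitable (fun N _ => FlowBound.ComplexityLE n N) ι R ℓ :=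
  hℓ.isInevitable
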